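/- All graphs are finite and undirected, without multiple edges, but possibly with loops (at most one at each vertex). The eigenvalues of a graph $\Gamma$ are those of its adjacency matrix, a loop contributing a diagonal entry $1$; $m(\lambda)$ denotes the multiplicity of $\lambda$ as an eigenvalue, with $m(\lambda)=0$ if $\lambda$ is not an eigenvalue. The spectrum of $\Gamma$ is the multiset of its eigenvalues, $\Gamma$ is integral if all its eigenvalues are integers, and its energy is the sum of the absolute values of its eigenvalues, counted with multiplicity. Two graphs with the same number of vertices are equienergetic if they have the same energy, and isospectral if they have the same spectrum. A graph is bipartite if its vertex set can be split into two classes such that every edge joins vertices of different classes (so a graph with a loop is not bipartite); it is simple if it has no loops. A graph $\Gamma$ with principal (largest) eigenvalue $\lambda_0$ is strongly almost symmetric if $m(\lambda)=m(-\lambda)$ for every $\lambda\neq\pm\lambda_0$ and $|m(\lambda_0)-m(-\lambda_0)|=1$. Let $R$ be a finite commutative ring with identity, and let $R\simeq R_1\times\cdots\times R_s$ be its decomposition into local rings, where $R_i$ has order $r_i$ and its maximal ideal has order $m_i$. Then $R$ is said to be of odd type if $m_i<r_i/2$ for every $i$ with $r_i$ even, and $r_i$ is odd for at least one $i$. Let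 $R^*$ be the group of units of $R$. Let $G_R=X(R,R^*)$ and $G_R^+=X^+(R,R^*)$ be the graphs with vertex set $R$ in which $v,w\in R$ are adjacent if and only if $w-v\in R^*$, respectively $v+w\in R^*$ (so $G_R^+$ has a loop at $v$ exactly when $2v\in R^*$). **Theorem.** Let $R$ be a finite commutative ring of odd type. Then $G_R$ and $G_R^+$ are undirected graphs which are both integral, connected and non-bipartite, and they are equienergetic but not isospectral. Moreover, if $|R|$ is even then $G_R^+$ is simple, and if $|R|$ is odd then $G_R^+$ is strongly almost symmetric and has loops. -/

import Mathlib

universe u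

namespace UnitaryCayley

/-! ### Finite graphs, possibly with loops

A graph is a `Digraph` (an adjacency relation in which loops are allowed). The relation is required
to be symmetric for the graph to be undirected. -/

section Graphs

variable {V : Type u}

/-- The graph is undirected: its adjacency relation is symmetric. -/
def IsUndirected (Γ : Digraph V) : Prop :=
  ∀ v w : V, Γ.Adj v w → Γ.Adj w v

/-- The graph has at least one loop. -/
def HasLoops (Γ : Digraph V) : Prop :=
  ∃ v : V, Γ.Adj v v

/-- The graph is simple: undirected and without loops (multiple edges are impossible here). -/
def IsSimple (Γ : Digraph V) : Prop :=
  IsUndirected Γ ∧ ¬ HasLoops Γ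

/-- The (undirected) graph is connected: it is non-empty and any two of its vertices are joined by a
path. -/
def IsConnected (Γ : Digraph V) : Prop :=
  Nonempty V ∧ ∀ v w : V, Relation.ReflTransGen Γ.Adj v w

/-- The graph is bipartite: its vertices can be split into two classes such that every edge joins
vertices in different classes. In particular a graph with a loop is not bipartite. -/
def IsBipartite (Γ : Digraph V) : Prop :=
  ∃ c : V → Bool, ∀ v w : V, Γ.Adj v w → c v ≠ c w

variable [Fintype V]

open Classical in
/-- The adjacency matrix: the entry at `(v, w)` is `1` if `v` and `w` are adjacent and `0` otherwise.
A loop at `v` gives the diagonal entry `1`. -/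
noncomputable def adjMat (Γ : Digraph V) : Matrix V V ℂ :=
  Matrix.of fun v w => if Γ.Adj v w then 1 else 0

open Classical in
/-- The spectrum: the multiset of all eigenvalues of the adjacency matrix, with multiplicities. -/
noncomputable def spec (Γ : Digraph V) : Multiset ℂ :=
  (adjMat Γ).charpoly.roots

open Classical in
/-- The multiplicity of `z` as an eigenvalue of the graph (`0` if it is not an eigenvalue). -/
noncomputable def mult (Γ : Digraph V) (z : ℂ) : ℕ :=
  (spec Γ).count z

/-- The graph is integral: all its eigenvalues are integers. -/
def IsIntegral (Γ : Digraph V) : Prop :=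
  ∀ z ∈ spec Γ, ∃ k : ℤ, z = (k : ℂ)

/-- The energy: the sum of the absolute values of all eigenvalues, with multiplicities. -/
noncomputable def energy (Γ : Digraph V) : ℝ :=
  ((spec Γ).map fun z => ‖z‖).sum

/-- Two graphs (on the same vertices) are equienergetic: their energies are equal. -/
def Equienergetic (Γ₁ Γ₂ : Digraph V) : Prop :=
  energy Γ₁ = energy Γ₂

/-- Two graphs (on the same vertices) are isospectral: their spectra coincide, with
multiplicities. -/
def Isospectral (Γ₁ Γ₂ : Digraph V) : Prop :=
  spec Γ₁ = spec Γ₂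

/-- `l` is the principal eigenvalue: a real eigenvalue with `|z| ≤ l` for every eigenvalue `z`. -/
def IsPrincipalEigenvalue (Γ : Digraph V) (l : ℝ) : Prop :=
  (l : ℂ) ∈ spec Γ ∧ ∀ z ∈ spec Γ, ‖z‖ ≤ l

/-- The graph is strongly almost symmetric: `z` and `-z` have the same multiplicity except when
`z` is plus or minus the principal eigenvalue `l`, and the multiplicities of `l` and `-l` differ by
exactly one. -/
def IsStronglyAlmostSymmetric (Γ : Digraph V) : Prop :=
  ∃ l : ℝ, IsPrincipalEigenvalue Γ l ∧
    (∀ z : ℂ, z ≠ (l : ℂ) → z ≠ -(l : ℂ) → mult Γ z = mult Γ (-z)) ∧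
    |(mult Γ (l : ℂ) : ℤ) - (mult Γ (-(l : ℂ)) : ℤ)| = 1

end Graphs

/-! ### Cayley graphs and Cayley sum graphs -/

/-- The Cayley graph `X(G,S)`: there is an edge from `v` to `w` if `w - v ∈ S`. -/
def cayleyGraph {G : Type u} [AddCommGroup G] (S : Set G) : Digraph G where
  Adj v w := w - v ∈ S

/-- The Cayley sum graph `X⁺(G,S)`: there is an edge from `v` to `w` if `v + w ∈ S`. -/
def cayleySumGraph {G : Type u} [AddCommGroup G] (S : Set G) : Digraph G where
  Adj v w := v + w ∈ S

/-- The unitary Cayley graph `G_R = X(R, R*)`. -/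
def unitaryCayleyGraph (R : Type u) [CommRing R] : Digraph R :=
  cayleyGraph {x : R | IsUnit x}

/-- The unitary Cayley sum graph `G_R⁺ = X⁺(R, R*)`. -/
def unitaryCayleySumGraph (R : Type u) [CommRing R] : Digraph R :=
  cayleySumGraph {x : R | IsUnit x}

/-! ### Rings of odd type -/

/-- The odd part of a product of finite rings `A i`: the product of the factors of odd order. It is
the one-element ring if there are none. -/
abbrev OddPart {s : ℕ} (A : Fin s → Type u) : Type u :=
  ∀ i : {i : Fin s // Odd (Nat.card (A i))}, A i.1

/-- A finite commutative ring `R` is of odd type: in the (essentially unique) decomposition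
`R ≃ A 0 × ⋯ × A (s - 1)` into local rings, every factor of even order `r` has a maximal ideal of
order `m < r / 2`, and the odd part is not the zero ring. -/
def IsOddType (R : Type u) [CommRing R] : Prop :=
  ∃ (s : ℕ) (A : Fin s → Type u) (_ : ∀ i, CommRing (A i)) (_ : ∀ i, IsLocalRing (A i)),
    Nonempty (R ≃+* ∀ i, A i) ∧
    (∀ i, Even (Nat.card (A i)) →
      (Nat.card (IsLocalRing.maximalIdeal (A i)) : ℚ) < (Nat.card (A i) : ℚ) / 2) ∧
    Nontrivial (OddPart A)

end UnitaryCayley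

/-!
For a symmetric subset `S` of a finite abelian group `G`, a character `χ` is an eigenvector of the
Cayley graph `X(G, S)` with eigenvalue `λ_χ = ∑ x ∈ S, χ x`, while the adjacency operator of the
Cayley sum graph `X⁺(G, S)` sends `χ` to `λ_χ χ⁻¹`. Since `λ_χ = λ_{χ⁻¹}`, the functions
`χ ± χ⁻¹` are eigenvectors of the latter with eigenvalues `± λ_χ`. Choosing signs `ε_χ`, equal to
`1` on the real characters and opposite on `χ` and `χ⁻¹` otherwise, one finds that the spectra are
`{λ_χ}` and `{ε_χ λ_χ}` (`spec_cayleyGraph`, `spec_cayleySumGraph`). Hence the two graphs have the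
same energy. If the trivial character is the only real one, as happens when `2` is invertible in
`R`, then the second spectrum is symmetric apart from `λ_1 = |S|`
(`isStronglyAlmostSymmetric_cayleySumGraph`).

For `S = R*` and `R ≃ ∏ A i` with `A i` local, `λ_χ` is the product of the corresponding sums for
the components of `χ`. In a local ring of order `r` with maximal ideal of order `m` such a sum is
`r - m` for the trivial character, and `0` or `-m` otherwise; this gives integrality.

For rings of odd type `2 m < r` holds in every factor. So no two cosets of the maximal ideals cover
a factor, and for all `v`, `w` in `R` there is `a` with `v + a` and `w + a` both units. This yields
paths of length two between any two vertices, and a triangle in each graph.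

If the graphs were isospectral, the eigenvalues of the non-real characters would be symmetric about
zero (`card_nonreal_charSum_neg`). They are not all zero, because some factor has odd order. Among
those of maximal absolute value there would then be a positive one. Its character has some
non-real component, and positivity forces a second non-trivial component; trivializing that one
replaces a factor `-m` by `r - m`, which is larger in absolute value, a contradiction
(`exists_nonreal_norm_charSum_lt`).
-/

namespace UnitaryCayley

/-! ### Spectra of Cayley graphs and Cayley sum graphs of finite abelian groups -/

/-- A basis of eigenvectors of the adjacency matrix determines the spectrum. -/
theorem spec_eq_map_of_eigenbasis {V : Type u} [Fintype V] {ι : Type*} [Fintype ι]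
    (Γ : Digraph V) (b : Module.Basis ι ℂ (V → ℂ)) (μ : ι → ℂ)
    (h : ∀ i, (adjMat Γ).mulVec (b i) = μ i • b i) :
    spec Γ = (Finset.univ : Finset ι).val.map μ := by
  classical
  have h1 : LinearMap.toMatrix b b (Matrix.toLin' (adjMat Γ)) = Matrix.diagonal μ := by
    ext i j
    rw [LinearMap.toMatrix_apply, Matrix.toLin'_apply, h]
    by_cases hij : i = j
    · simp [hij]
    · simp [hij]
  have h2 : (adjMat Γ).charpoly = ∏ i, (Polynomial.X - Polynomial.C (μ i)) := by
    rw [← Matrix.charpoly_diagonal, ← h1, LinearMap.charpoly_toMatrix,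
      ← LinearMap.charpoly_toMatrix _ (Pi.basisFun ℂ V), LinearMap.toMatrix_eq_toMatrix',
      LinearMap.toMatrix'_toLin']
  unfold spec
  convert Polynomial.roots_multiset_prod_X_sub_C ((Finset.univ : Finset ι).val.map μ) using 2
  rw [Multiset.map_map]
  convert h2
  rfl

section Characters

variable {G : Type u} [AddCommGroup G] [Fintype G]

open scoped Classical in
/-- The sum of the values of the character `χ` over the set `S`. -/
noncomputable def charSum (S : Set G) (χ : AddChar G ℂ) : ℂ :=
  ∑ x, if x ∈ S then χ x else 0

theorem norm_charSum_le (S : Set G) (χ : AddChar G ℂ) : ‖charSum S χ‖ ≤ Nat.card S := by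
  classical
  refine (norm_sum_le _ _).trans (le_of_eq ?_)
  rw [Nat.card_eq_fintype_card, Fintype.card_subtype, ← Finset.sum_boole]
  refine Finset.sum_congr rfl fun x _ => ?_
  split_ifs <;> simp [AddChar.norm_apply]

theorem charSum_one (S : Set G) : charSum S 1 = Nat.card S := by
  classical
  rw [Nat.card_eq_fintype_card, Fintype.card_subtype, ← Finset.sum_boole]
  simp [charSum]

theorem charSum_inv {S : Set G} (hS : ∀ x, -x ∈ S ↔ x ∈ S) (χ : AddChar G ℂ) :
    charSum S χ⁻¹ = charSum S χ := by
  classical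
  refine Fintype.sum_equiv (Equiv.neg G) _ _ fun x => ?_
  simp [hS]

theorem adjMat_cayleyGraph_mulVec (S : Set G) (χ : AddChar G ℂ) :
    (adjMat (cayleyGraph S)).mulVec χ = charSum S χ • ⇑χ := by
  classical
  funext v
  rw [Matrix.mulVec, dotProduct, Pi.smul_apply, charSum, smul_eq_mul, Finset.sum_mul]
  refine Fintype.sum_equiv (Equiv.subRight v) _ _ fun w => ?_
  by_cases h : w - v ∈ S <;> simp [adjMat, cayleyGraph, h, ← AddChar.map_add_eq_mul]

theorem adjMat_cayleySumGraph_mulVec (S : Set G) (χ : AddChar G ℂ) :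
    (adjMat (cayleySumGraph S)).mulVec χ = charSum S χ • ⇑χ⁻¹ := by
  classical
  funext v
  rw [Matrix.mulVec, dotProduct, Pi.smul_apply, charSum, smul_eq_mul, Finset.sum_mul]
  refine Fintype.sum_equiv (Equiv.addLeft v) _ _ fun w => ?_
  by_cases h : v + w ∈ S <;> simp [adjMat, cayleySumGraph, h, ← AddChar.map_add_eq_mul]

theorem spec_cayleyGraph (S : Set G) :
    spec (cayleyGraph S) = (Finset.univ : Finset (AddChar G ℂ)).val.map (charSum S) :=
  spec_eq_map_of_eigenbasis _ (AddChar.complexBasis G) _ fun χ => by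
    rw [AddChar.complexBasis_apply, adjMat_cayleyGraph_mulVec]

open scoped Classical in
/-- A choice of sign for every character, equal to `1` on the real characters (those with
`χ⁻¹ = χ`) and taking opposite values on a non-real character and its inverse. -/
noncomputable def charSign (χ : AddChar G ℂ) : ℂ :=
  if Fintype.equivFin _ χ ≤ Fintype.equivFin _ χ⁻¹ then 1 else -1

theorem charSign_eq_or (χ : AddChar G ℂ) : charSign χ = 1 ∨ charSign χ = -1 := by
  unfold charSign; split_ifs <;> simp

theorem charSign_mul_self (χ : AddChar G ℂ) : charSign χ * charSign χ = 1 := by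
  rcases charSign_eq_or χ with h | h <;> simp [h]

theorem charSign_of_inv_eq {χ : AddChar G ℂ} (h : χ⁻¹ = χ) : charSign χ = 1 := by
  simp [charSign, h]

theorem charSign_inv {χ : AddChar G ℂ} (h : χ⁻¹ ≠ χ) : charSign χ⁻¹ = -charSign χ := by
  have hne : Fintype.equivFin _ χ⁻¹ ≠ Fintype.equivFin _ χ := by simpa using h
  unfold charSign
  rw [inv_inv]
  rcases hne.lt_or_gt with h | h
  · simp [h.le, h.not_ge]
  · simp [h.le, h.not_ge]

/-- The functions `χ + ε χ⁻¹`, with `ε` the sign of `χ`, span all functions: for a non-real `χ`,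
those of `χ` and `χ⁻¹` are multiples of the even and the odd part of `χ`, in some order. -/
theorem span_charSign_eq_top :
    ⊤ ≤ Submodule.span ℂ (Set.range fun χ : AddChar G ℂ => (⇑χ + charSign χ • ⇑χ⁻¹ : G → ℂ)) := by
  rw [← (AddChar.complexBasis G).span_eq, Submodule.span_le]
  rintro _ ⟨χ, rfl⟩
  rw [AddChar.complexBasis_apply]
  set b : AddChar G ℂ → G → ℂ := fun χ => ⇑χ + charSign χ • ⇑χ⁻¹ with hb
  have hmem : ∀ χ, b χ ∈ Submodule.span ℂ (Set.range b) := fun χ =>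
    Submodule.subset_span ⟨χ, rfl⟩
  by_cases h : χ⁻¹ = χ
  · have : (χ : G → ℂ) = (2⁻¹ : ℂ) • b χ := by
      funext x
      simp only [hb, charSign_of_inv_eq h, h, Pi.smul_apply, Pi.add_apply, smul_eq_mul]
      ring
    rw [this]
    exact Submodule.smul_mem _ _ (hmem χ)
  · have : (χ : G → ℂ) = (2⁻¹ : ℂ) • (b χ - charSign χ • b χ⁻¹) := by
      funext x
      simp only [hb, charSign_inv h, inv_inv, Pi.smul_apply, Pi.add_apply, Pi.sub_apply,
        smul_eq_mul]
      linear_combination (-(2⁻¹ : ℂ) * χ x) * charSign_mul_self χ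
    rw [this]
    exact Submodule.smul_mem _ _ (Submodule.sub_mem _ (hmem χ) (Submodule.smul_mem _ _ (hmem _)))

theorem spec_cayleySumGraph {S : Set G} (hS : ∀ x, -x ∈ S ↔ x ∈ S) :
    spec (cayleySumGraph S) =
      (Finset.univ : Finset (AddChar G ℂ)).val.map fun χ => charSign χ * charSum S χ := by
  have hcard : Fintype.card (AddChar G ℂ) = Module.finrank ℂ (G → ℂ) := by
    rw [AddChar.card_eq, Module.finrank_fintype_fun_eq_card]
  refine spec_eq_map_of_eigenbasis _
    (basisOfTopLeSpanOfCardEqFinrank _ span_charSign_eq_top hcard) _ fun χ => ?_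
  rw [coe_basisOfTopLeSpanOfCardEqFinrank, Matrix.mulVec_add, Matrix.mulVec_smul,
    adjMat_cayleySumGraph_mulVec, adjMat_cayleySumGraph_mulVec, inv_inv, charSum_inv hS]
  funext x
  simp only [Pi.smul_apply, Pi.add_apply, smul_eq_mul]
  linear_combination (-(charSum S χ) * χ⁻¹ x) * charSign_mul_self χ

theorem equienergetic_cayleyGraph_cayleySumGraph {S : Set G} (hS : ∀ x, -x ∈ S ↔ x ∈ S) :
    Equienergetic (cayleyGraph S) (cayleySumGraph S) := by
  unfold Equienergetic energy
  rw [spec_cayleyGraph, spec_cayleySumGraph hS, Multiset.map_map, Multiset.map_map]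
  congr 1
  refine Multiset.map_congr rfl fun χ _ => ?_
  rcases charSign_eq_or χ with h | h <;> simp [h]

open scoped Classical in
/-- Inversion of characters flips the sign of the eigenvalues of the Cayley sum graph that come from
non-real characters. -/
theorem card_nonreal_charSign_neg {S : Set G} (hS : ∀ x, -x ∈ S ↔ x ∈ S) (z : ℂ) :
    (Finset.univ.filter fun χ : AddChar G ℂ => χ⁻¹ ≠ χ ∧ charSign χ * charSum S χ = z).card =
    (Finset.univ.filter fun χ : AddChar G ℂ => χ⁻¹ ≠ χ ∧ charSign χ * charSum S χ = -z).card := by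
  refine Finset.card_equiv (Equiv.inv _) fun χ => ?_
  simp only [Finset.mem_filter, Finset.mem_univ, true_and, Equiv.inv_apply, inv_inv]
  rw [ne_comm (a := χ)]
  refine and_congr_right fun h => ?_
  rw [charSign_inv h, charSum_inv hS, neg_mul, neg_inj]

open scoped Classical in
/-- Multiplicities split into the contributions of the real and of the non-real characters. -/
theorem count_map_eq_card_real_add_card_nonreal (f : AddChar G ℂ → ℂ) (z : ℂ) :
    ((Finset.univ : Finset (AddChar G ℂ)).val.map f).count z =
      (Finset.univ.filter fun χ => χ⁻¹ = χ ∧ f χ = z).card +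
      (Finset.univ.filter fun χ => χ⁻¹ ≠ χ ∧ f χ = z).card := by
  rw [Multiset.count_map]
  change (Finset.univ.filter fun χ => z = f χ).card = _
  rw [← Finset.card_filter_add_card_filter_not (fun χ : AddChar G ℂ => χ⁻¹ = χ),
    Finset.filter_filter, Finset.filter_filter]
  congr 2 <;> ext χ <;> simp only [Finset.mem_filter, and_comm, eq_comm (a := z), ne_eq]

open scoped Classical in
/-- If the two graphs are isospectral, then the eigenvalues of the non-real characters are symmetric
about zero. -/
theorem card_nonreal_charSum_neg {S : Set G} (hS : ∀ x, -x ∈ S ↔ x ∈ S)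
    (h : Isospectral (cayleyGraph S) (cayleySumGraph S)) (z : ℂ) :
    (Finset.univ.filter fun χ : AddChar G ℂ => χ⁻¹ ≠ χ ∧ charSum S χ = z).card =
    (Finset.univ.filter fun χ : AddChar G ℂ => χ⁻¹ ≠ χ ∧ charSum S χ = -z).card := by
  -- The real characters contribute the same eigenvalues to both spectra.
  have key : ∀ z : ℂ,
      (Finset.univ.filter fun χ : AddChar G ℂ => χ⁻¹ ≠ χ ∧ charSum S χ = z).card =
      (Finset.univ.filter fun χ : AddChar G ℂ =>
        χ⁻¹ ≠ χ ∧ charSign χ * charSum S χ = z).card := by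
    intro z
    unfold Isospectral at h
    rw [spec_cayleyGraph, spec_cayleySumGraph hS] at h
    have h1 := congrArg (Multiset.count z) h
    rw [count_map_eq_card_real_add_card_nonreal, count_map_eq_card_real_add_card_nonreal] at h1
    have h2 : (Finset.univ.filter fun χ : AddChar G ℂ => χ⁻¹ = χ ∧ charSum S χ = z) =
        Finset.univ.filter fun χ => χ⁻¹ = χ ∧ charSign χ * charSum S χ = z := by
      refine Finset.filter_congr fun χ _ => and_congr_right fun hχ => ?_
      rw [charSign_of_inv_eq hχ, one_mul]
    rw [h2] at h1
    omega
  rw [key, key, card_nonreal_charSign_neg hS]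

/-- If the trivial character is the only real one, the spectrum of the Cayley sum graph is symmetric
apart from the principal eigenvalue, which comes from the trivial character. -/
theorem isStronglyAlmostSymmetric_cayleySumGraph {S : Set G} (hS : ∀ x, -x ∈ S ↔ x ∈ S)
    (hne : S.Nonempty) (hreal : ∀ χ : AddChar G ℂ, χ⁻¹ = χ → χ = 1) :
    IsStronglyAlmostSymmetric (cayleySumGraph S) := by
  classical
  have hspec := spec_cayleySumGraph hS
  have hone : charSign (1 : AddChar G ℂ) * charSum S 1 = Nat.card S := by
    rw [charSign_of_inv_eq inv_one, one_mul, charSum_one]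
  have hpos : 0 < Nat.card S := by
    have := hne.to_subtype
    exact Nat.card_pos
  have hmult : ∀ z : ℂ, mult (cayleySumGraph S) z = (if z = Nat.card S then 1 else 0) +
      (Finset.univ.filter fun χ : AddChar G ℂ =>
        χ⁻¹ ≠ χ ∧ charSign χ * charSum S χ = z).card := by
    intro z
    have h1 := count_map_eq_card_real_add_card_nonreal
      (fun χ : AddChar G ℂ => charSign χ * charSum S χ) z
    rw [← hspec] at h1
    unfold mult
    convert h1 using 2
    have h2 : (Finset.univ.filter fun χ : AddChar G ℂ =>
        χ⁻¹ = χ ∧ charSign χ * charSum S χ = z) =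
        if z = Nat.card S then {1} else ∅ := by
      ext χ
      rw [Finset.mem_filter]
      constructor
      · rintro ⟨-, h3, h4⟩
        obtain rfl := hreal χ h3
        rw [hone] at h4
        rw [if_pos h4.symm, Finset.mem_singleton]
      · intro h3
        split_ifs at h3 with h4
        · rw [Finset.mem_singleton] at h3
          subst h3
          exact ⟨Finset.mem_univ _, inv_one, hone.trans h4.symm⟩
        · simp at h3
    rw [h2]
    split_ifs <;> simp
  have hcast : (((Nat.card S : ℕ) : ℝ) : ℂ) = ((Nat.card S : ℕ) : ℂ) := by simp
  refine ⟨Nat.card S, ⟨?_, ?_⟩, ?_, ?_⟩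
  · rw [hspec, Multiset.mem_map, hcast]
    exact ⟨1, Finset.mem_univ_val _, hone⟩
  · intro z hz
    rw [hspec, Multiset.mem_map] at hz
    obtain ⟨χ, -, rfl⟩ := hz
    rcases charSign_eq_or χ with h | h <;> simpa [h] using norm_charSum_le S χ
  · intro z h1 h2
    rw [hcast] at h1 h2
    rw [hmult, hmult, if_neg h1, if_neg (by rwa [neg_eq_iff_eq_neg]), card_nonreal_charSign_neg hS]
  · rw [hcast, hmult, hmult, if_pos rfl, if_neg, card_nonreal_charSign_neg hS]
    · simp
    · intro h
      have h1 : ((Nat.card S : ℕ) : ℂ) = 0 := by linear_combination -(2⁻¹ : ℂ) * h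
      exact hpos.ne' (by exact_mod_cast h1)

end Characters

/-! ### Finite local rings -/

section Local

theorem isUnit_two_iff_odd_card (A : Type u) [CommRing A] [Finite A] :
    IsUnit (2 : A) ↔ Odd (Nat.card A) := by
  have := Fintype.ofFinite A
  constructor
  · intro h
    by_contra hodd
    rw [Nat.not_odd_iff_even, even_iff_two_dvd] at hodd
    obtain ⟨x, hx⟩ := exists_prime_addOrderOf_dvd_card' 2 hodd
    have h1 : (2 : A) * x = 0 := by
      have h2 := addOrderOf_nsmul_eq_zero x
      rwa [hx, nsmul_eq_mul, Nat.cast_ofNat] at h2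
    rw [h.mul_right_eq_zero] at h1
    simp [h1] at hx
  · rintro ⟨k, hk⟩
    have h1 : ((Nat.card A : ℕ) : A) = 0 := by
      rw [Nat.card_eq_fintype_card, Nat.cast_card_eq_zero]
    rw [hk] at h1
    push_cast at h1
    exact IsUnit.of_mul_eq_one (-(k : A)) (by linear_combination -h1)

/-- If `2` is invertible, the trivial additive character is the only real one. -/
theorem eq_one_of_inv_eq {A : Type u} [CommRing A] (h2 : IsUnit (2 : A)) {χ : AddChar A ℂ}
    (h : χ⁻¹ = χ) : χ = 1 := by
  rw [AddChar.eq_one_iff]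
  intro x
  obtain ⟨y, rfl⟩ := h2.dvd (a := x)
  rw [two_mul, AddChar.map_add_eq_mul]
  nth_rewrite 1 [← h]
  rw [AddChar.inv_apply, ← AddChar.map_add_eq_mul, neg_add_cancel, AddChar.map_zero_eq_one]

variable {A : Type u} [CommRing A] [IsLocalRing A]

open IsLocalRing

/-- In odd order the index of the maximal ideal is odd and not `1`, hence at least `3`. -/
theorem two_mul_card_maximalIdeal_lt_of_odd [Finite A] (h : Odd (Nat.card A)) :
    2 * Nat.card (maximalIdeal A) < Nat.card A := by
  obtain ⟨q, hq⟩ : Nat.card (maximalIdeal A) ∣ Nat.card A :=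
    (maximalIdeal A).toAddSubgroup.card_addSubgroup_dvd_card
  have hpos : 0 < Nat.card (maximalIdeal A) := Nat.card_pos
  have hq1 : q ≠ 1 := by
    rintro rfl
    have h1 : (maximalIdeal A).toAddSubgroup = ⊤ :=
      AddSubgroup.eq_top_of_card_eq _ (by rw [hq, mul_one]; rfl)
    have h2 : (1 : A) ∈ (maximalIdeal A).toAddSubgroup := h1 ▸ AddSubgroup.mem_top _
    exact (Ideal.ne_top_iff_one _).1 (maximalIdeal.isMaximal A).ne_top h2
  rw [hq, Nat.odd_mul] at h
  obtain ⟨k, hk⟩ := h.2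
  have hq3 : 2 < q := by omega
  rw [hq, mul_comm]
  exact Nat.mul_lt_mul_of_pos_left hq3 hpos

/-- When the maximal ideal fills less than half of the ring, two of its cosets cannot cover it. -/
theorem exists_isUnit_add_isUnit_add [Finite A]
    (h : 2 * Nat.card (maximalIdeal A) < Nat.card A) (v w : A) :
    ∃ a, IsUnit (v + a) ∧ IsUnit (w + a) := by
  classical
  have := Fintype.ofFinite A
  by_contra! hcon
  have hcard : ∀ v : A, (Finset.univ.filter fun a => ¬ IsUnit (v + a)).card =
      Nat.card (maximalIdeal A) := by
    intro v
    rw [Nat.card_eq_fintype_card]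
    refine Eq.trans ?_ (Fintype.card_subtype (fun a : A => a ∈ maximalIdeal A)).symm
    exact Finset.card_equiv (Equiv.addLeft v) fun a => by simp
  have hcover : (Finset.univ : Finset A) ⊆ (Finset.univ.filter fun a => ¬ IsUnit (v + a)) ∪
      Finset.univ.filter fun a => ¬ IsUnit (w + a) := by
    intro a _
    by_cases ha : IsUnit (v + a)
    · simp [hcon a ha]
    · simp [ha]
  have h1 := (Finset.card_le_card hcover).trans (Finset.card_union_le _ _)
  rw [hcard, hcard, Finset.card_univ, ← Nat.card_eq_fintype_card] at h1
  omega

variable [Fintype A]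

theorem charSum_units_eq_sub [Fintype (maximalIdeal A)] (ψ : AddChar A ℂ) :
    charSum {x : A | IsUnit x} ψ = ∑ x, ψ x - ∑ x : maximalIdeal A, ψ x := by
  classical
  have h1 : ∑ x : maximalIdeal A, ψ x = ∑ x, if x ∈ maximalIdeal A then ψ x else 0 := by
    rw [← Finset.sum_filter]
    exact (Finset.sum_subtype _ (by simp) _).symm
  rw [h1, ← Finset.sum_sub_distrib, charSum]
  refine Finset.sum_congr rfl fun x _ => ?_
  by_cases hx : IsUnit x <;> simp [hx]

theorem charSum_units_one :
    charSum {x : A | IsUnit x} 1 = Nat.card A - Nat.card (maximalIdeal A) := by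
  have := Fintype.ofFinite (maximalIdeal A)
  rw [charSum_units_eq_sub, Nat.card_eq_fintype_card, Nat.card_eq_fintype_card]
  simp [-mem_maximalIdeal]

theorem charSum_units_of_trivial {ψ : AddChar A ℂ} (hψ : ψ ≠ 1)
    (h : ∀ x ∈ maximalIdeal A, ψ x = 1) :
    charSum {x : A | IsUnit x} ψ = -Nat.card (maximalIdeal A) := by
  have := Fintype.ofFinite (maximalIdeal A)
  rw [charSum_units_eq_sub, AddChar.sum_eq_zero_iff_ne_zero.2 hψ,
    Finset.sum_congr rfl fun x _ => h x.1 x.2, Nat.card_eq_fintype_card]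
  simp [-mem_maximalIdeal]

theorem charSum_units_eq_or {ψ : AddChar A ℂ} (hψ : ψ ≠ 1) :
    charSum {x : A | IsUnit x} ψ = 0 ∨
      charSum {x : A | IsUnit x} ψ = -Nat.card (maximalIdeal A) := by
  by_cases h : ∀ x ∈ maximalIdeal A, ψ x = 1
  · exact Or.inr (charSum_units_of_trivial hψ h)
  · left
    have := Fintype.ofFinite (maximalIdeal A)
    have h1 : ψ.compAddMonoidHom (maximalIdeal A).subtype.toAddMonoidHom ≠ 0 := by
      rw [AddChar.ne_zero_iff]
      push Not at h
      obtain ⟨x, hx, hx1⟩ := h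
      exact ⟨⟨x, hx⟩, hx1⟩
    rw [charSum_units_eq_sub, AddChar.sum_eq_zero_iff_ne_zero.2 hψ, zero_sub, neg_eq_zero]
    exact AddChar.sum_eq_zero_iff_ne_zero.2 h1

theorem exists_int_charSum_units (ψ : AddChar A ℂ) :
    ∃ k : ℤ, charSum {x : A | IsUnit x} ψ = k := by
  by_cases hψ : ψ = 1
  · exact ⟨Nat.card A - Nat.card (maximalIdeal A), by rw [hψ, charSum_units_one]; push_cast; rfl⟩
  · rcases charSum_units_eq_or hψ with h | h
    · exact ⟨0, by simp [h]⟩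
    · exact ⟨-Nat.card (maximalIdeal A), by rw [h]; push_cast; rfl⟩

/-- In odd characteristic, a non-trivial character of the residue field gives a non-real character
with non-zero eigenvalue. -/
theorem exists_nonreal_charSum_units_ne_zero (h2 : IsUnit (2 : A)) :
    ∃ ψ : AddChar A ℂ, ψ⁻¹ ≠ ψ ∧ charSum {x : A | IsUnit x} ψ ≠ 0 := by
  have : Finite (A ⧸ maximalIdeal A) := Quotient.finite _
  obtain ⟨φ, hφ⟩ := (AddChar.exists_apply_ne_zero (a := (1 : A ⧸ maximalIdeal A))).2 one_ne_zero
  let ψ : AddChar A ℂ := φ.compAddMonoidHom (Ideal.Quotient.mk (maximalIdeal A)).toAddMonoidHom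
  have hψ : ψ ≠ 1 := AddChar.ne_one_iff.2 ⟨1, by simpa [ψ] using hφ⟩
  refine ⟨ψ, fun h => hψ (eq_one_of_inv_eq h2 h), ?_⟩
  have htriv : ∀ x ∈ maximalIdeal A, ψ x = 1 := by
    intro x hx
    simp [ψ, Ideal.Quotient.eq_zero_iff_mem.2 hx]
  rw [charSum_units_of_trivial hψ htriv, neg_ne_zero]
  exact Nat.cast_ne_zero.2 Nat.card_pos.ne'

end Local

/-! ### Products of finite local rings -/

section Product

theorem addChar_map_sum {ι G : Type*} [AddCommMonoid G] (χ : AddChar G ℂ) (s : Finset ι)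
    (f : ι → G) : χ (∑ i ∈ s, f i) = ∏ i ∈ s, χ (f i) := by
  classical
  induction s using Finset.induction_on with
  | empty => simp
  | insert i s hi ih => rw [Finset.sum_insert hi, Finset.prod_insert hi, χ.map_add_eq_mul, ih]

theorem units_neg_mem {R : Type u} [CommRing R] (x : R) :
    -x ∈ {x : R | IsUnit x} ↔ x ∈ {x : R | IsUnit x} :=
  IsUnit.neg_iff x

variable {R : Type u} [CommRing R] {ι : Type*} [Fintype ι] {A : ι → Type u}
  [∀ i, CommRing (A i)]

/-- The character of `R ≃ ∏ A i` with the given components. -/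
noncomputable def charOfComponents (e : R ≃+* ∀ i, A i) (ψ : ∀ i, AddChar (A i) ℂ) :
    AddChar R ℂ where
  toFun x := ∏ i, ψ i (e x i)
  map_zero_eq_one' := by simp
  map_add_eq_mul' x y := by simp [AddChar.map_add_eq_mul, Finset.prod_mul_distrib]

theorem charOfComponents_apply (e : R ≃+* ∀ i, A i) (ψ : ∀ i, AddChar (A i) ℂ) (x : R) :
    charOfComponents e ψ x = ∏ i, ψ i (e x i) := rfl

theorem charOfComponents_inv (e : R ≃+* ∀ i, A i) (ψ : ∀ i, AddChar (A i) ℂ) :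
    (charOfComponents e ψ)⁻¹ = charOfComponents e fun i => (ψ i)⁻¹ := by
  ext x
  simp [charOfComponents_apply]

theorem charOfComponents_injective (e : R ≃+* ∀ i, A i) :
    Function.Injective (charOfComponents e) := by
  classical
  intro ψ φ h
  funext i
  ext a
  have key : ∀ ψ : ∀ i, AddChar (A i) ℂ,
      charOfComponents e ψ (e.symm (Pi.single i a)) = ψ i a := by
    intro ψ
    rw [charOfComponents_apply, RingEquiv.apply_symm_apply,
      Finset.prod_eq_single i (fun k _ hk => by simp [hk]) (by simp), Pi.single_eq_same]
  rw [← key ψ, ← key φ, h]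

theorem charOfComponents_surjective (e : R ≃+* ∀ i, A i) :
    Function.Surjective (charOfComponents e) := by
  classical
  intro χ
  refine ⟨fun i => χ.compAddMonoidHom
    (e.symm.toAddMonoidHom.comp (AddMonoidHom.single A i)), ?_⟩
  ext x
  have h : x = ∑ i, e.symm (Pi.single i (e x i)) := by
    rw [← map_sum, Finset.univ_sum_single, RingEquiv.symm_apply_apply]
  conv_rhs => rw [h, addChar_map_sum]
  rfl

variable [Fintype R] [∀ i, Fintype (A i)]

theorem charSum_units_charOfComponents (e : R ≃+* ∀ i, A i) (ψ : ∀ i, AddChar (A i) ℂ) :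
    charSum {x : R | IsUnit x} (charOfComponents e ψ) =
      ∏ i, charSum {x : A i | IsUnit x} (ψ i) := by
  classical
  simp only [charSum]
  rw [Fintype.prod_sum]
  refine Fintype.sum_equiv e.toEquiv _ _ fun x => ?_
  have hunit : x ∈ {x : R | IsUnit x} ↔ ∀ i, IsUnit (e x i) := by
    change IsUnit x ↔ _
    rw [← MulEquiv.isUnit_map e, Pi.isUnit_iff]
  by_cases hx : x ∈ {x : R | IsUnit x}
  · rw [if_pos hx, charOfComponents_apply]
    exact Finset.prod_congr rfl fun i _ => (if_pos (hunit.1 hx i)).symm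
  · rw [if_neg hx]
    obtain ⟨i, hi⟩ := not_forall.1 (mt hunit.2 hx)
    exact (Finset.prod_eq_zero (Finset.mem_univ i) (if_neg hi)).symm

theorem exists_int_charSum_units_of_ringEquiv [∀ i, IsLocalRing (A i)] (e : R ≃+* ∀ i, A i)
    (χ : AddChar R ℂ) : ∃ k : ℤ, charSum {x : R | IsUnit x} χ = k := by
  obtain ⟨ψ, rfl⟩ := charOfComponents_surjective e χ
  choose k hk using fun i => exists_int_charSum_units (ψ i)
  exact ⟨∏ i, k i, by rw [charSum_units_charOfComponents]; push_cast; simp only [hk]⟩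

/-- A positive eigenvalue of a non-real character is not maximal in absolute value among the
eigenvalues of non-real characters: the character has a second non-trivial component, and making
that one trivial multiplies the absolute value by `(r - m) / m > 1`. -/
theorem exists_nonreal_norm_charSum_lt [∀ i, IsLocalRing (A i)] (e : R ≃+* ∀ i, A i)
    (hm : ∀ i, 2 * Nat.card (IsLocalRing.maximalIdeal (A i)) < Nat.card (A i))
    {χ : AddChar R ℂ} (hχ : χ⁻¹ ≠ χ) {k : ℤ} (hk : 0 < k)
    (hχk : charSum {x : R | IsUnit x} χ = k) :
    ∃ χ' : AddChar R ℂ, χ'⁻¹ ≠ χ' ∧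
      ‖charSum {x : R | IsUnit x} χ‖ < ‖charSum {x : R | IsUnit x} χ'‖ := by
  classical
  obtain ⟨ψ, rfl⟩ := charOfComponents_surjective e χ
  have hm' : ∀ i, 2 * (Nat.card (IsLocalRing.maximalIdeal (A i)) : ℝ) < Nat.card (A i) :=
    fun i => by exact_mod_cast hm i
  have hmpos : ∀ i, 0 < (Nat.card (IsLocalRing.maximalIdeal (A i)) : ℝ) :=
    fun i => by exact_mod_cast Nat.card_pos
  have hprod := hχk
  rw [charSum_units_charOfComponents] at hprod
  have hne : ∀ i, charSum {x : A i | IsUnit x} (ψ i) ≠ 0 := by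
    intro i
    have h1 : ∏ i, charSum {x : A i | IsUnit x} (ψ i) ≠ 0 := by
      rw [hprod]
      exact_mod_cast hk.ne'
    exact Finset.prod_ne_zero_iff.1 h1 i (Finset.mem_univ i)
  have hval : ∀ i, ψ i ≠ 1 → charSum {x : A i | IsUnit x} (ψ i) =
      -Nat.card (IsLocalRing.maximalIdeal (A i)) :=
    fun i hi => (charSum_units_eq_or hi).resolve_left (hne i)
  obtain ⟨j, hj⟩ : ∃ j, (ψ j)⁻¹ ≠ ψ j := by
    by_contra! hall
    exact hχ (by rw [charOfComponents_inv]; simp only [hall])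
  have hj1 : ψ j ≠ 1 := fun h => hj (by rw [h, inv_one])
  by_cases hl : ∃ l, l ≠ j ∧ ψ l ≠ 1
  · obtain ⟨l, hlj, hl1⟩ := hl
    refine ⟨charOfComponents e (Function.update ψ l 1), ?_, ?_⟩
    · rw [charOfComponents_inv]
      intro h
      have h1 := congrFun (charOfComponents_injective e h) j
      simp only [Function.update_of_ne hlj.symm] at h1
      exact hj h1
    · rw [charSum_units_charOfComponents, charSum_units_charOfComponents, norm_prod, norm_prod,
        ← Finset.mul_prod_erase _ _ (Finset.mem_univ l),
        ← Finset.mul_prod_erase _ _ (Finset.mem_univ l)]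
      have h1 : ∏ i ∈ Finset.univ.erase l,
          ‖charSum {x : A i | IsUnit x} (Function.update ψ l 1 i)‖ =
          ∏ i ∈ Finset.univ.erase l, ‖charSum {x : A i | IsUnit x} (ψ i)‖ :=
        Finset.prod_congr rfl fun i hi => by
          rw [Function.update_of_ne (Finset.ne_of_mem_erase hi)]
      rw [h1, Function.update_self]
      refine mul_lt_mul_of_pos_right ?_ (Finset.prod_pos fun i _ => norm_pos_iff.2 (hne i))
      rw [hval l hl1, charSum_units_one, norm_neg, Complex.norm_natCast]
      have h2 : ((Nat.card (A l) : ℂ) - Nat.card (IsLocalRing.maximalIdeal (A l))) =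
          (((Nat.card (A l) : ℝ) - Nat.card (IsLocalRing.maximalIdeal (A l)) : ℝ) : ℂ) := by
        push_cast; rfl
      rw [h2, Complex.norm_real, Real.norm_eq_abs]
      refine lt_of_lt_of_le ?_ (le_abs_self _)
      linarith [hm' l]
  · -- With a single non-trivial component the eigenvalue would be negative.
    push Not at hl
    exfalso
    have h1 : (k : ℂ) = ((-(Nat.card (IsLocalRing.maximalIdeal (A j)) : ℝ) *
        ∏ i ∈ Finset.univ.erase j, ((Nat.card (A i) : ℝ) -
          Nat.card (IsLocalRing.maximalIdeal (A i))) : ℝ) : ℂ) := by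
      rw [← hprod, ← Finset.mul_prod_erase _ _ (Finset.mem_univ j), hval j hj1]
      push_cast
      congr 1
      refine Finset.prod_congr rfl fun i hi => ?_
      rw [hl i (Finset.ne_of_mem_erase hi), charSum_units_one]
    have h2 : (k : ℝ) = -(Nat.card (IsLocalRing.maximalIdeal (A j)) : ℝ) *
        ∏ i ∈ Finset.univ.erase j, ((Nat.card (A i) : ℝ) -
          Nat.card (IsLocalRing.maximalIdeal (A i))) := by
      exact_mod_cast h1
    have h3 : 0 < ∏ i ∈ Finset.univ.erase j, ((Nat.card (A i) : ℝ) -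
        Nat.card (IsLocalRing.maximalIdeal (A i))) :=
      Finset.prod_pos fun i _ => by linarith [hm' i, hmpos i]
    have h4 : (0 : ℝ) < k := by exact_mod_cast hk
    have h5 := mul_pos (hmpos j) h3
    linarith

/-- Isospectrality would make the eigenvalues of the non-real characters symmetric about zero, hence
give a positive one of maximal absolute value among them. -/
theorem not_isospectral_of_ringEquiv [∀ i, IsLocalRing (A i)] (e : R ≃+* ∀ i, A i)
    (hm : ∀ i, 2 * Nat.card (IsLocalRing.maximalIdeal (A i)) < Nat.card (A i))
    (hodd : ∃ j, IsUnit (2 : A j)) :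
    ¬ Isospectral (unitaryCayleyGraph R) (unitaryCayleySumGraph R) := by
  classical
  intro hiso
  have hsym := card_nonreal_charSum_neg (S := {x : R | IsUnit x}) units_neg_mem hiso
  obtain ⟨j, hj⟩ := hodd
  obtain ⟨φ, hφ, hφ0⟩ := exists_nonreal_charSum_units_ne_zero hj
  let T := Finset.univ.filter fun χ : AddChar R ℂ => χ⁻¹ ≠ χ ∧ charSum {x : R | IsUnit x} χ ≠ 0
  have hT : T.Nonempty := by
    refine ⟨charOfComponents e (Function.update 1 j φ),
      Finset.mem_filter.2 ⟨Finset.mem_univ _, ?_, ?_⟩⟩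
    · rw [charOfComponents_inv]
      intro h
      have h1 := congrFun (charOfComponents_injective e h) j
      simp only [Function.update_self] at h1
      exact hφ h1
    · rw [charSum_units_charOfComponents, Finset.prod_ne_zero_iff]
      intro i _
      by_cases hij : i = j
      · subst hij
        rwa [Function.update_self]
      · rw [Function.update_of_ne hij, Pi.one_apply, charSum_units_one, sub_ne_zero, ne_eq,
          Nat.cast_inj]
        have := hm i
        omega
  obtain ⟨χ₀, hχ₀, hmax⟩ := T.exists_max_image (fun χ => ‖charSum {x : R | IsUnit x} χ‖) hT
  obtain ⟨-, hχ₀, hne⟩ := Finset.mem_filter.1 hχ₀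
  have hmax' : ∀ χ : AddChar R ℂ, χ⁻¹ ≠ χ →
      ‖charSum {x : R | IsUnit x} χ‖ ≤ ‖charSum {x : R | IsUnit x} χ₀‖ := by
    intro χ hχ
    by_cases h0 : charSum {x : R | IsUnit x} χ = 0
    · rw [h0, norm_zero]
      exact norm_nonneg _
    · exact hmax χ (Finset.mem_filter.2 ⟨Finset.mem_univ _, hχ, h0⟩)
  obtain ⟨k, hk⟩ := exists_int_charSum_units_of_ringEquiv e χ₀
  have hk0 : k ≠ 0 := by
    rintro rfl
    exact hne (by simpa using hk)
  rcases hk0.lt_or_gt with hneg | hpos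
  · -- By symmetry the opposite of a negative eigenvalue also comes from a non-real character.
    have h1 : 0 < (Finset.univ.filter fun χ : AddChar R ℂ =>
        χ⁻¹ ≠ χ ∧ charSum {x : R | IsUnit x} χ = k).card :=
      Finset.card_pos.2 ⟨χ₀, Finset.mem_filter.2 ⟨Finset.mem_univ _, hχ₀, hk⟩⟩
    rw [hsym, Finset.card_pos] at h1
    obtain ⟨χ₁, hχ₁⟩ := h1
    obtain ⟨-, hχ₁, hk₁⟩ := Finset.mem_filter.1 hχ₁
    obtain ⟨χ', hχ', hlt⟩ := exists_nonreal_norm_charSum_lt e hm hχ₁ (k := -k) (by omega)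
      (by rw [hk₁]; push_cast; rfl)
    rw [hk₁, norm_neg, ← hk] at hlt
    exact absurd (hmax' χ' hχ') hlt.not_ge
  · obtain ⟨χ', hχ', hlt⟩ := exists_nonreal_norm_charSum_lt e hm hχ₀ hpos hk
    exact absurd (hmax' χ' hχ') hlt.not_ge

end Product

/-! ### Connectedness and odd closed walks -/

section Walks

variable {R : Type u} [CommRing R]

theorem exists_isUnit_add_isUnit_add_of_ringEquiv {ι : Type*} {A : ι → Type u}
    [∀ i, CommRing (A i)] [∀ i, IsLocalRing (A i)] [∀ i, Finite (A i)] (e : R ≃+* ∀ i, A i)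
    (hm : ∀ i, 2 * Nat.card (IsLocalRing.maximalIdeal (A i)) < Nat.card (A i)) (v w : R) :
    ∃ a, IsUnit (v + a) ∧ IsUnit (w + a) := by
  choose a ha using fun i => exists_isUnit_add_isUnit_add (hm i) (e v i) (e w i)
  refine ⟨e.symm a, ?_, ?_⟩
  · rw [← MulEquiv.isUnit_map e, map_add, RingEquiv.apply_symm_apply, Pi.isUnit_iff]
    exact fun i => (ha i).1
  · rw [← MulEquiv.isUnit_map e, map_add, RingEquiv.apply_symm_apply, Pi.isUnit_iff]
    exact fun i => (ha i).2

theorem isConnected_unitaryCayleyGraph (h : ∀ v w : R, ∃ a, IsUnit (v + a) ∧ IsUnit (w + a)) :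
    IsConnected (unitaryCayleyGraph R) := by
  refine ⟨⟨0⟩, fun v w => ?_⟩
  obtain ⟨a, hv, hw⟩ := h (-v) (-w)
  have h1 : (unitaryCayleyGraph R).Adj v a := by
    change IsUnit (a - v)
    rwa [sub_eq_neg_add]
  have h2 : (unitaryCayleyGraph R).Adj a w := by
    change IsUnit (w - a)
    rw [← IsUnit.neg_iff]
    convert hw using 1
    ring
  exact (Relation.ReflTransGen.single h1).tail h2

theorem isConnected_unitaryCayleySumGraph (h : ∀ v w : R, ∃ a, IsUnit (v + a) ∧ IsUnit (w + a)) :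
    IsConnected (unitaryCayleySumGraph R) := by
  refine ⟨⟨0⟩, fun v w => ?_⟩
  obtain ⟨a, hv, hw⟩ := h v w
  have h2 : (unitaryCayleySumGraph R).Adj a w := by
    change IsUnit (a + w)
    rwa [add_comm]
  exact (Relation.ReflTransGen.single hv).tail h2

theorem not_isBipartite_of_triangle {V : Type u} {Γ : Digraph V} {x y z : V} (hxy : Γ.Adj x y)
    (hyz : Γ.Adj y z) (hxz : Γ.Adj x z) : ¬ IsBipartite Γ := by
  rintro ⟨c, hc⟩
  have h1 := hc _ _ hxy
  have h2 := hc _ _ hyz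
  have h3 := hc _ _ hxz
  revert h1 h2 h3
  cases c x <;> cases c y <;> cases c z <;> simp

theorem not_isBipartite_unitaryCayleyGraph
    (h : ∀ v w : R, ∃ a, IsUnit (v + a) ∧ IsUnit (w + a)) :
    ¬ IsBipartite (unitaryCayleyGraph R) := by
  obtain ⟨a, h0, h1⟩ := h 0 (-1)
  refine not_isBipartite_of_triangle (x := 0) (y := 1) (z := a) ?_ ?_ ?_
  · change IsUnit ((1 : R) - 0)
    simp
  · change IsUnit (a - 1)
    rwa [sub_eq_neg_add]
  · change IsUnit (a - 0)
    rwa [sub_zero, ← zero_add a]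

theorem not_isBipartite_unitaryCayleySumGraph
    (h : ∀ v w : R, ∃ a, IsUnit (v + a) ∧ IsUnit (w + a)) :
    ¬ IsBipartite (unitaryCayleySumGraph R) := by
  obtain ⟨a, h0, h1⟩ := h 0 1
  refine not_isBipartite_of_triangle (x := 0) (y := 1) (z := a) ?_ h1 h0
  change IsUnit ((0 : R) + 1)
  simp

theorem hasLoops_unitaryCayleySumGraph_iff :
    HasLoops (unitaryCayleySumGraph R) ↔ IsUnit (2 : R) := by
  constructor
  · rintro ⟨v, hv⟩
    change IsUnit (v + v) at hv
    rw [← two_mul] at hv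
    exact isUnit_of_mul_isUnit_left hv
  · intro h
    refine ⟨1, ?_⟩
    change IsUnit ((1 : R) + 1)
    rwa [one_add_one_eq_two]

theorem isUndirected_unitaryCayleyGraph : IsUndirected (unitaryCayleyGraph R) := by
  intro v w h
  change IsUnit (v - w)
  rw [← neg_sub]
  exact h.neg

theorem isUndirected_unitaryCayleySumGraph : IsUndirected (unitaryCayleySumGraph R) := by
  intro v w h
  change IsUnit (w + v)
  rw [add_comm]
  exact h

end Walks

end UnitaryCayley

/-! ### Rings of odd type -/

theorem mainTheorem4 {R : Type u} [CommRing R] [Fintype R] (hR : UnitaryCayley.IsOddType R) :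
    (UnitaryCayley.IsUndirected (UnitaryCayley.unitaryCayleyGraph R) ∧
      UnitaryCayley.IsUndirected (UnitaryCayley.unitaryCayleySumGraph R)) ∧
    (UnitaryCayley.IsIntegral (UnitaryCayley.unitaryCayleyGraph R) ∧
      UnitaryCayley.IsIntegral (UnitaryCayley.unitaryCayleySumGraph R)) ∧
    UnitaryCayley.Equienergetic (UnitaryCayley.unitaryCayleyGraph R)
      (UnitaryCayley.unitaryCayleySumGraph R) ∧
    ¬ UnitaryCayley.Isospectral (UnitaryCayley.unitaryCayleyGraph R)
      (UnitaryCayley.unitaryCayleySumGraph R) ∧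
    (UnitaryCayley.IsConnected (UnitaryCayley.unitaryCayleyGraph R) ∧
      UnitaryCayley.IsConnected (UnitaryCayley.unitaryCayleySumGraph R)) ∧
    (¬ UnitaryCayley.IsBipartite (UnitaryCayley.unitaryCayleyGraph R) ∧
      ¬ UnitaryCayley.IsBipartite (UnitaryCayley.unitaryCayleySumGraph R)) ∧
    (Even (Fintype.card R) →
      UnitaryCayley.IsSimple (UnitaryCayley.unitaryCayleySumGraph R)) ∧
    (Odd (Fintype.card R) →
      UnitaryCayley.IsStronglyAlmostSymmetric (UnitaryCayley.unitaryCayleySumGraph R) ∧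
        UnitaryCayley.HasLoops (UnitaryCayley.unitaryCayleySumGraph R)) := by
  open UnitaryCayley in
  obtain ⟨s, A, _, _, ⟨e⟩, heven, hodd⟩ := hR
  have hfin : ∀ i, Finite (A i) := fun i =>
    Finite.of_surjective (fun x => e x i) ((Function.surjective_eval i).comp e.surjective)
  have hfintype : ∀ i, Fintype (A i) := fun i => Fintype.ofFinite (A i)
  have hm : ∀ i, 2 * Nat.card (IsLocalRing.maximalIdeal (A i)) < Nat.card (A i) := by
    intro i
    rcases Nat.even_or_odd (Nat.card (A i)) with h | h
    · have h1 := heven i h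
      rw [lt_div_iff₀ two_pos, mul_comm] at h1
      exact_mod_cast h1
    · exact two_mul_card_maximalIdeal_lt_of_odd h
  have htwo : ∃ j, IsUnit (2 : A j) := by
    by_contra! hno
    have : IsEmpty {i // Odd (Nat.card (A i))} :=
      ⟨fun i => hno i.1 ((isUnit_two_iff_odd_card _).2 i.2)⟩
    exact not_subsingleton (OddPart A) inferInstance
  have hadd := exists_isUnit_add_isUnit_add_of_ringEquiv e hm
  have hint := exists_int_charSum_units_of_ringEquiv e
  have hspec : spec (unitaryCayleyGraph R) = _ := spec_cayleyGraph _
  have hspec' : spec (unitaryCayleySumGraph R) = _ := spec_cayleySumGraph units_neg_mem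
  refine ⟨⟨isUndirected_unitaryCayleyGraph, isUndirected_unitaryCayleySumGraph⟩, ⟨?_, ?_⟩,
    equienergetic_cayleyGraph_cayleySumGraph units_neg_mem, not_isospectral_of_ringEquiv e hm htwo,
    ⟨isConnected_unitaryCayleyGraph hadd, isConnected_unitaryCayleySumGraph hadd⟩,
    ⟨not_isBipartite_unitaryCayleyGraph hadd, not_isBipartite_unitaryCayleySumGraph hadd⟩,
    fun h => ⟨isUndirected_unitaryCayleySumGraph, ?_⟩, fun h => ?_⟩
  · intro z hz
    rw [hspec, Multiset.mem_map] at hz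
    obtain ⟨χ, -, rfl⟩ := hz
    exact hint χ
  · intro z hz
    rw [hspec', Multiset.mem_map] at hz
    obtain ⟨χ, -, rfl⟩ := hz
    obtain ⟨k, hk⟩ := hint χ
    rcases charSign_eq_or χ with h | h
    · exact ⟨k, by rw [h, hk, one_mul]⟩
    · exact ⟨-k, by rw [h, hk]; push_cast; ring⟩
  · rw [hasLoops_unitaryCayleySumGraph_iff, isUnit_two_iff_odd_card, Nat.card_eq_fintype_card,
      Nat.not_odd_iff_even]
    exact h
  · rw [← Nat.card_eq_fintype_card, ← isUnit_two_iff_odd_card] at h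
    exact ⟨isStronglyAlmostSymmetric_cayleySumGraph units_neg_mem ⟨1, isUnit_one⟩
      fun χ hχ => eq_one_of_inv_eq h hχ, hasLoops_unitaryCayleySumGraph_iff.2 h⟩
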